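/- Let $\mathcal H_A$ and $\mathcal H_B$ be finite-dimensional complex Hilbert spaces and let $\rho_{AB}$ be a density matrix (a positive semidefinite operator with unit trace) on $\mathcal H_A\otimes\mathcal H_B$. Put $\rho_A=\operatorname{Tr}_B\rho_{AB}$, and define the conditional min-entropy of $A$ given $B$ by $$H_{\min}(A|B)_\rho:=-\log_2\inf\{\operatorname{Tr}\upsilon_B \mid \upsilon_B\ge 0,\ \rho_{AB}\le \mathbb 1_A\otimes\upsilon_B\},$$ where $X\le Y$ means that $Y-X$ is positive semidefinite. For real $t$, powers of $\rho_A$ are taken on its support: if $\rho_A=\sum_j\lambda_j\Pi_j$ is the spectral decomposition, then $\rho_A^{t}:=\sum_{\lambda_j>0}\lambda_j^{t}\,\Pi_j$ (in particular, $\rho_A^0$ is the projection onto the support of $\rho_A$). Then for every $s\in\mathbb R$, $$-\log_2\Big(\sqrt{\operatorname{Tr}\rho_A^{s}}\;\operatorname{Tr}_B\sqrt{\operatorname{Tr}_A\big(\rho_{AB}\,\rho_A^{-s}\,\rho_{AB}\big)}\Big)\;\le\; H_{\min}(A|B)_\rho\;\le\;-\log_2\left(\frac{\Big(\operatorname{Tr}_B\sqrt{\operatorname{Tr}_A\big(\rho_{AB}\,\rho_A^{-s}\,\rho_{AB}\big)}\Big)^{2}}{\operatorname{Tr}\rho_A^{1-s}}\right),$$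 where $\rho_A^{-s}$ inside the partial trace stands for $\rho_A^{-s}\otimes\mathbb 1_B$. -/

import Mathlib

open scoped Kronecker ComplexOrder MatrixOrder

noncomputable section

namespace QuantumMinEntropy

variable {a b n : Type*}

/-- A density matrix: positive semidefinite with unit trace. -/
structure IsDensityMatrix [Fintype n] (ρ : Matrix n n ℂ) : Prop where
  posSemidef : ρ.PosSemidef
  trace_eq_one : ρ.trace = 1

/-- The partial trace over the first tensor factor `A` of an operator on `A ⊗ B`. -/
def partialTraceA [Fintype a] (M : Matrix (a × b) (a × b) ℂ) : Matrix b b ℂ :=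
  Matrix.of fun j j' => ∑ i : a, M (i, j) (i, j')

/-- The partial trace over the second tensor factor `B` of an operator on `A ⊗ B`. -/
def partialTraceB [Fintype b] (M : Matrix (a × b) (a × b) ℂ) : Matrix a a ℂ :=
  Matrix.of fun i i' => ∑ j : b, M (i, j) (i', j)

/-- The real power `M ^ s` of a positive semidefinite matrix, taken on its support:
if `M = ∑ λᵢ Πᵢ` is the spectral decomposition, this is `∑_{λᵢ > 0} λᵢ ^ s Πᵢ`.
In particular, for `s = 0` it is the projection onto the support of `M`. -/
def supportPow [Fintype n] [DecidableEq n] (M : Matrix n n ℂ) (s : ℝ) : Matrix n n ℂ :=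
  cfc (fun x : ℝ => if 0 < x then x ^ s else 0) M

/-- The set of traces of positive semidefinite `υ` on `B` with `ρ ≤ 1 ⊗ υ`. -/
def feasibleTraces [Fintype b] [DecidableEq a] (ρ : Matrix (a × b) (a × b) ℂ) : Set ℝ :=
  {t : ℝ | ∃ υ : Matrix b b ℂ, υ.PosSemidef ∧ ρ ≤ (1 : Matrix a a ℂ) ⊗ₖ υ ∧ t = υ.trace.re}

/-- The conditional min-entropy
`H_min(A|B)_ρ = - log₂ inf {Tr υ | υ ≥ 0, ρ ≤ 1 ⊗ υ}`. -/
def condMinEntropy [Fintype b] [DecidableEq a] (ρ : Matrix (a × b) (a × b) ℂ) : ℝ :=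
  - Real.logb 2 (sInf (feasibleTraces ρ))

/-- `Tr_B √(Tr_A (ρ_AB (ρ_A ^ (-s) ⊗ 1) ρ_AB))`, where `ρ_A = Tr_B ρ_AB`. -/
def weightedRootTrace [Fintype a] [Fintype b] [DecidableEq a] [DecidableEq b]
    (ρ : Matrix (a × b) (a × b) ℂ) (s : ℝ) : ℝ :=
  (CFC.sqrt (partialTraceA
    (ρ * (supportPow (partialTraceB ρ) (-s) ⊗ₖ (1 : Matrix b b ℂ)) * ρ))).trace.re

end QuantumMinEntropy

end

/-!
The min-entropy is the value of a semidefinite program: minimize `Tr υ` over `υ ≥ 0` with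
`ρ ≤ 1 ⊗ υ`. Its dual maximizes `Re Tr (ρ E)` over `E ≥ 0` with `Tr_A E ≤ 1`. Write `σ = ρ_A`,
`L = ρ (σ ^ (-s/2) ⊗ 1)` and `X = Tr_A (L Lᴴ) = Tr_A (ρ σ ^ (-s) ρ)`, with powers on supports.

*Upper bound on the entropy.* By weak duality (`re_trace_mul_le_of_le_one_kronecker`) every dual
feasible `E` bounds the optimum from below. For `E = X ^ (-1/2) L Lᴴ X ^ (-1/2)`, whose marginal
`Tr_A E` is the support projection of `X`, and a square root `Q` of `ρ`,
`Tr √X = Tr (X ^ (-1/2) L Lᴴ) = Tr ((Q X ^ (-1/2) L) (σ ^ (-s/2) Q))`, and Cauchy–Schwarz gives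
`(Tr √X)² ≤ Tr (ρ E) Tr σ ^ (1 - s)` (`weightedRootTrace_sq_le`).

*Lower bound on the entropy.* By strong duality (`exists_posSemidef_le_one_kronecker`, a
Hahn–Banach separation) it suffices to bound `Tr (ρ E)` for every dual feasible `E`. Since the
support of `ρ` lies in that of `σ ⊗ 1`, `Tr (ρ E) = Tr (L Nᴴ)` with `N = E (σ ^ (s/2) ⊗ 1)`.
Inserting `X ^ (1/4) X ^ (-1/4)` on `B` and using Cauchy–Schwarz bounds this by `√c Tr √X` as soon
as `Tr_A (N Nᴴ) ≤ c` (`re_trace_mul_conjTranspose_sq_le`). That this holds with `c = Tr σ ^ s` is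
`posSemidef_trace_smul_one_sub_partialTraceA`: if `E = G²` is dual feasible, then
`G (σ ^ s ⊗ 1) G ≤ Tr σ ^ s`, hence `Tr_A (E σ ^ s E) ≤ Tr σ ^ s Tr_A E`.
-/

namespace QuantumMinEntropy

open Matrix

variable {a b n m : Type*}

/-! ### Powers on the support -/

section SupportPow

variable [Fintype n] [DecidableEq n]

theorem posSemidef_supportPow (M : Matrix n n ℂ) (s : ℝ) : (supportPow M s).PosSemidef := by
  rw [← Matrix.nonneg_iff_posSemidef]
  refine cfc_nonneg fun x _ => ?_
  split_ifs with h
  · exact (Real.rpow_pos_of_pos h _).le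
  · exact le_rfl

/-- Exponents add without any positivity assumption on `M`, since the defining function vanishes on
`(-∞, 0]` for every exponent. -/
theorem supportPow_mul (M : Matrix n n ℂ) (s t : ℝ) :
    supportPow M s * supportPow M t = supportPow M (s + t) := by
  have hc (f : ℝ → ℝ) : ContinuousOn f (spectrum ℝ M) := M.finite_real_spectrum.continuousOn f
  rw [supportPow, supportPow, ← cfc_mul _ _ M (hc _) (hc _)]
  refine cfc_congr fun x _ => ?_
  split_ifs with h
  · exact (Real.rpow_add h s t).symm
  · simp

theorem supportPow_one {M : Matrix n n ℂ} (hM : M.PosSemidef) : supportPow M 1 = M := by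
  have h0 : (0 : Matrix n n ℂ) ≤ M := Matrix.nonneg_iff_posSemidef.2 hM
  conv_rhs => rw [← cfc_id' ℝ M hM.isHermitian]
  refine cfc_congr fun x hx => ?_
  have := spectrum_nonneg_of_nonneg h0 hx
  split_ifs with h
  · simp
  · linarith

theorem supportPow_mul_self {M : Matrix n n ℂ} (hM : M.PosSemidef) (s : ℝ) :
    supportPow M s * M = supportPow M (s + 1) := by
  rw [← supportPow_mul, supportPow_one hM]

theorem sqrt_eq_supportPow {M : Matrix n n ℂ} (hM : M.PosSemidef) :
    CFC.sqrt M = supportPow M (1 / 2) := by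
  refine CFC.sqrt_unique ?_ (Matrix.nonneg_iff_posSemidef.2 (posSemidef_supportPow M _))
  rw [supportPow_mul]
  norm_num [supportPow_one hM]

/-- The support projection is at most the identity. -/
theorem posSemidef_one_sub_supportPow_zero (M : Matrix n n ℂ) :
    (1 - supportPow M 0).PosSemidef := by
  have h : supportPow M 0 * supportPow M 0 = supportPow M 0 := by
    rw [supportPow_mul, add_zero]
  have hh := (posSemidef_supportPow M 0).isHermitian.eq
  have := Matrix.posSemidef_self_mul_conjTranspose (1 - supportPow M 0)
  simpa [hh, sub_mul, mul_sub, h] using this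

theorem exists_isHermitian_mul_self {M : Matrix n n ℂ} (hM : M.PosSemidef) :
    ∃ C : Matrix n n ℂ, C.IsHermitian ∧ C * C = M := by
  refine ⟨supportPow M (1 / 2), (posSemidef_supportPow M _).isHermitian, ?_⟩
  rw [supportPow_mul]
  norm_num [supportPow_one hM]

end SupportPow

/-! ### Traces of products -/

theorem trace_mul_conjTranspose_self_re [Fintype n] [Fintype m] (A : Matrix n m ℂ) :
    (A * Aᴴ).trace.re = ∑ i, ∑ j, ‖A i j‖ ^ 2 := by
  simp [Matrix.trace, Matrix.mul_apply, Complex.mul_conj, Complex.normSq_eq_norm_sq,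
    -Complex.ofReal_pow]

/-- The Cauchy–Schwarz inequality for the Hilbert–Schmidt inner product. -/
theorem re_trace_mul_sq_le [Fintype n] [Fintype m] (A : Matrix n m ℂ) (B : Matrix m n ℂ) :
    (A * B).trace.re ^ 2 ≤ (A * Aᴴ).trace.re * (Bᴴ * B).trace.re := by
  have hB : (Bᴴ * B).trace.re = ∑ i, ∑ j, ‖B j i‖ ^ 2 := by
    simpa using trace_mul_conjTranspose_self_re Bᴴ
  have h1 : |(A * B).trace.re| ≤ ∑ p : n × m, ‖A p.1 p.2‖ * ‖B p.2 p.1‖ := by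
    refine (Complex.abs_re_le_norm _).trans ?_
    simp only [Matrix.trace, Matrix.diag_apply, Matrix.mul_apply, ← Fintype.sum_prod_type']
    exact (norm_sum_le _ _).trans (Finset.sum_le_sum fun p _ => (norm_mul _ _).le)
  rw [trace_mul_conjTranspose_self_re, hB]
  simp only [← Fintype.sum_prod_type']
  rw [← sq_abs]
  exact (pow_le_pow_left₀ (abs_nonneg _) h1 2).trans (Finset.sum_mul_sq_le_sq_mul_sq _ _ _)

theorem trace_re_nonneg [Fintype n] {A : Matrix n n ℂ} (hA : A.PosSemidef) : 0 ≤ A.trace.re :=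
  (Complex.nonneg_iff.1 hA.trace_nonneg).1

theorem re_trace_mul_nonneg [Fintype n] {A B : Matrix n n ℂ} (hA : A.PosSemidef)
    (hB : B.PosSemidef) : 0 ≤ (A * B).trace.re := by
  classical
  obtain ⟨C, hC, rfl⟩ := exists_isHermitian_mul_self hB
  rw [← Matrix.mul_assoc, Matrix.trace_mul_comm, ← Matrix.mul_assoc]
  simpa [hC.eq] using trace_re_nonneg (hA.mul_mul_conjTranspose_same C)

theorem posSemidef_of_re_nonneg [Fintype n] {A : Matrix n n ℂ} (hA : A.IsHermitian)
    (h : ∀ x : n → ℂ, 0 ≤ (star x ⬝ᵥ (A *ᵥ x)).re) : A.PosSemidef :=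
  .of_dotProduct_mulVec_nonneg hA fun x => Complex.nonneg_iff.2
    ⟨h x, (hA.im_star_dotProduct_mulVec_self x).symm⟩

theorem star_dotProduct_self_re [Fintype n] (x : n → ℂ) : (star x ⬝ᵥ x).re = ∑ i, ‖x i‖ ^ 2 := by
  simp [dotProduct, ← Complex.normSq_eq_norm_sq, Complex.normSq_apply]

/-! ### Partial traces -/

@[simp] theorem trace_partialTraceA [Fintype a] [Fintype b] (M : Matrix (a × b) (a × b) ℂ) :
    (partialTraceA M).trace = M.trace := by
  simp only [partialTraceA, Matrix.trace, Matrix.diag_apply, Matrix.of_apply,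
    Fintype.sum_prod_type_right]

@[simp] theorem trace_partialTraceB [Fintype a] [Fintype b] (M : Matrix (a × b) (a × b) ℂ) :
    (partialTraceB M).trace = M.trace := by
  simp only [partialTraceB, Matrix.trace, Matrix.diag_apply, Matrix.of_apply,
    Fintype.sum_prod_type]

theorem partialTraceA_one_kronecker_mul [Fintype a] [Fintype b] [DecidableEq a]
    (S : Matrix b b ℂ) (M : Matrix (a × b) (a × b) ℂ) :
    partialTraceA ((1 : Matrix a a ℂ) ⊗ₖ S * M) = S * partialTraceA M := by
  ext j j'
  simp only [partialTraceA, Matrix.mul_apply, Matrix.of_apply, Fintype.sum_prod_type,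
    Matrix.kroneckerMap_apply, Matrix.one_apply, ite_mul, one_mul, zero_mul, Finset.mul_sum]
  rw [Finset.sum_comm]
  simp [Finset.sum_comm (γ := b)]

theorem partialTraceA_mul_one_kronecker [Fintype a] [Fintype b] [DecidableEq a]
    (S : Matrix b b ℂ) (M : Matrix (a × b) (a × b) ℂ) :
    partialTraceA (M * (1 : Matrix a a ℂ) ⊗ₖ S) = partialTraceA M * S := by
  ext j j'
  simp only [partialTraceA, Matrix.mul_apply, Matrix.of_apply, Fintype.sum_prod_type,
    Matrix.kroneckerMap_apply, Matrix.one_apply, ite_mul, one_mul, zero_mul, Finset.sum_mul,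
    mul_ite, mul_zero]
  rw [Finset.sum_comm]
  simp [Finset.sum_comm (γ := b)]

theorem partialTraceB_kronecker_one_mul [Fintype a] [Fintype b] [DecidableEq b]
    (S : Matrix a a ℂ) (M : Matrix (a × b) (a × b) ℂ) :
    partialTraceB (S ⊗ₖ (1 : Matrix b b ℂ) * M) = S * partialTraceB M := by
  ext i i'
  simp only [partialTraceB, Matrix.mul_apply, Matrix.of_apply, Fintype.sum_prod_type,
    Matrix.kroneckerMap_apply, Matrix.one_apply, mul_ite, ite_mul, mul_one, mul_zero, zero_mul,
    Finset.mul_sum]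
  rw [Finset.sum_comm]
  simp

theorem trace_one_kronecker_mul [Fintype a] [Fintype b] [DecidableEq a]
    (S : Matrix b b ℂ) (M : Matrix (a × b) (a × b) ℂ) :
    ((1 : Matrix a a ℂ) ⊗ₖ S * M).trace = (S * partialTraceA M).trace := by
  rw [← partialTraceA_one_kronecker_mul, trace_partialTraceA]

theorem trace_kronecker_one_mul [Fintype a] [Fintype b] [DecidableEq b]
    (S : Matrix a a ℂ) (M : Matrix (a × b) (a × b) ℂ) :
    (S ⊗ₖ (1 : Matrix b b ℂ) * M).trace = (S * partialTraceB M).trace := by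
  rw [← partialTraceB_kronecker_one_mul, trace_partialTraceB]

theorem partialTraceA_eq_sum [Fintype a] (M : Matrix (a × b) (a × b) ℂ) :
    partialTraceA M = ∑ i, M.submatrix (Prod.mk i) (Prod.mk i) := by
  ext j j'
  simp [partialTraceA, Matrix.sum_apply]

theorem partialTraceB_eq_sum [Fintype b] (M : Matrix (a × b) (a × b) ℂ) :
    partialTraceB M = ∑ j, M.submatrix (fun i => (i, j)) (fun i => (i, j)) := by
  ext i i'
  simp [partialTraceB, Matrix.sum_apply]

theorem posSemidef_partialTraceA [Fintype a] {M : Matrix (a × b) (a × b) ℂ} (hM : M.PosSemidef) :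
    (partialTraceA M).PosSemidef := by
  rw [partialTraceA_eq_sum]
  exact Matrix.posSemidef_sum _ fun i _ => hM.submatrix _

theorem posSemidef_partialTraceB [Fintype b] {M : Matrix (a × b) (a × b) ℂ} (hM : M.PosSemidef) :
    (partialTraceB M).PosSemidef := by
  rw [partialTraceB_eq_sum]
  exact Matrix.posSemidef_sum _ fun i _ => hM.submatrix _

theorem partialTraceA_sub [Fintype a] (M N : Matrix (a × b) (a × b) ℂ) :
    partialTraceA (M - N) = partialTraceA M - partialTraceA N := by
  ext; simp [partialTraceA]

theorem partialTraceA_smul [Fintype a] (c : ℝ) (M : Matrix (a × b) (a × b) ℂ) :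
    partialTraceA (c • M) = c • partialTraceA M := by
  ext; simp [partialTraceA, Finset.mul_sum]

/-! ### Duality for the min-entropy optimization -/

/-- Weak duality: every dual feasible point `E` bounds the traces of all primal feasible points
from below. -/
theorem re_trace_mul_le_of_le_one_kronecker [Fintype a] [Fintype b] [DecidableEq a]
    [DecidableEq b] {ρ E : Matrix (a × b) (a × b) ℂ} {υ : Matrix b b ℂ} (hυ : υ.PosSemidef)
    (hρ : ρ ≤ (1 : Matrix a a ℂ) ⊗ₖ υ) (hE : E.PosSemidef)
    (hE1 : (1 - partialTraceA E).PosSemidef) : (ρ * E).trace.re ≤ υ.trace.re := by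
  have h1 := re_trace_mul_nonneg (Matrix.le_iff.1 hρ) hE
  have h2 := re_trace_mul_nonneg hυ hE1
  rw [sub_mul, Matrix.trace_sub, trace_one_kronecker_mul, Complex.sub_re] at h1
  rw [mul_sub, mul_one, Matrix.trace_sub, Complex.sub_re] at h2
  linarith

/-- Every complex linear functional on matrices has the form `M ↦ Tr (G M)`. -/
theorem exists_trace_mul_eq [Fintype n] [DecidableEq n] (f : Matrix n n ℂ →ₗ[ℂ] ℂ) :
    ∃ G : Matrix n n ℂ, ∀ M, f M = (G * M).trace := by
  refine ⟨Matrix.of fun i j => f (Matrix.single j i 1), fun M => ?_⟩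
  conv_lhs => rw [Matrix.matrix_eq_sum_single M]
  simp only [map_sum, Matrix.trace, Matrix.diag_apply, Matrix.mul_apply, Matrix.of_apply]
  rw [Finset.sum_comm]
  refine Finset.sum_congr rfl fun i _ => Finset.sum_congr rfl fun j _ => ?_
  rw [← mul_one (M j i), ← smul_eq_mul, ← Matrix.smul_single, map_smul]
  simp [mul_comm]

theorem trace_mul_vecMulVec_star [Fintype n] (M : Matrix n n ℂ) (x : n → ℂ) :
    (M * vecMulVec x (star x)).trace = star x ⬝ᵥ (M *ᵥ x) := by
  rw [Matrix.mul_vecMulVec, Matrix.trace_vecMulVec, dotProduct_comm]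

/-- The Gram matrices `wᴴ w` of trace at most `t` form a compact set. -/
theorem isCompact_gram [Fintype n] (t : ℝ) :
    IsCompact {υ : Matrix n n ℂ | ∃ w : Matrix n n ℂ, (w * wᴴ).trace.re ≤ t ∧ wᴴ * w = υ} := by
  have h1 : IsCompact {w : Matrix n n ℂ | (w * wᴴ).trace.re ≤ t} := by
    -- Every entry of `w` has modulus at most `√t`, since `Tr (w wᴴ)` is the sum of all `|w i j|²`.
    have hK : IsCompact (Set.univ.pi fun _ : n => Set.univ.pi fun _ : n =>
        Metric.closedBall (0 : ℂ) (Real.sqrt t)) :=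
      isCompact_univ_pi fun _ => isCompact_univ_pi fun _ => isCompact_closedBall _ _
    refine IsCompact.of_isClosed_subset hK ?_ fun w hw i _ j _ => ?_
    · refine isClosed_le ?_ continuous_const
      exact Complex.continuous_re.comp
        (continuous_id.matrix_mul continuous_id.matrix_conjTranspose).matrix_trace
    · rw [mem_closedBall_zero_iff]
      refine Real.le_sqrt_of_sq_le ?_
      rw [Set.mem_ofPred_eq, trace_mul_conjTranspose_self_re] at hw
      refine le_trans ?_ hw
      refine le_trans ?_ (Finset.single_le_sum (f := fun i => ∑ j, ‖w i j‖ ^ 2)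
        (fun _ _ => by positivity) (Finset.mem_univ i))
      exact Finset.single_le_sum (f := fun j => ‖w i j‖ ^ 2)
        (fun _ _ => by positivity) (Finset.mem_univ j)
  exact h1.image (continuous_id.matrix_conjTranspose.matrix_mul continuous_id)

theorem setOf_posSemidef_trace_le_eq_gram [Fintype n] (t : ℝ) :
    {υ : Matrix n n ℂ | υ.PosSemidef ∧ υ.trace.re ≤ t} =
      {υ | ∃ w : Matrix n n ℂ, (w * wᴴ).trace.re ≤ t ∧ wᴴ * w = υ} := by
  classical
  ext υ
  constructor
  · rintro ⟨h, ht⟩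
    obtain ⟨C, hC, rfl⟩ := exists_isHermitian_mul_self h
    exact ⟨C, by rwa [hC.eq], by rw [hC.eq]⟩
  · rintro ⟨w, hw, rfl⟩
    exact ⟨Matrix.posSemidef_conjTranspose_mul_self w, by rwa [Matrix.trace_mul_comm]⟩

theorem isCompact_posSemidef_trace_le [Fintype n] (t : ℝ) :
    IsCompact {υ : Matrix n n ℂ | υ.PosSemidef ∧ υ.trace.re ≤ t} :=
  setOf_posSemidef_trace_le_eq_gram (n := n) t ▸ isCompact_gram t

theorem convex_posSemidef_trace_le [Fintype n] (t : ℝ) :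
    Convex ℝ {υ : Matrix n n ℂ | υ.PosSemidef ∧ υ.trace.re ≤ t} := by
  rintro x ⟨hx, hxt⟩ y ⟨hy, hyt⟩ p q hp hq hpq
  refine ⟨(hx.smul hp).add (hy.smul hq), ?_⟩
  simp only [Matrix.trace_add, Matrix.trace_smul, Complex.add_re, Complex.smul_re, smul_eq_mul]
  calc _ ≤ p * t + q * t := by gcongr
    _ = t := by rw [← add_mul, hpq, one_mul]

/-- Matrices are locally convex, as a finite product of copies of `ℂ`. Hahn–Banach separation
requires this. -/
instance instLocallyConvexSpaceMatrix : LocallyConvexSpace ℝ (Matrix n n ℂ) :=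
  inferInstanceAs (LocallyConvexSpace ℝ (n → n → ℂ))

/-- Strong duality: an upper bound `t` for the dual problem
`max {Re Tr (ρ E) | E ≥ 0, Tr_A E ≤ 1}` is attained or undercut by a primal feasible `υ`.
Otherwise the compact convex set `{ρ - 1 ⊗ υ | υ ≥ 0, Tr υ ≤ t}` misses the closed convex cone
of matrices with nonpositive numerical range, and a separating functional, normalized, is a dual
feasible point with value exceeding `t`. -/
theorem exists_posSemidef_le_one_kronecker [Fintype a] [Fintype b] [DecidableEq a]
    [DecidableEq b] {ρ : Matrix (a × b) (a × b) ℂ} (hρ : ρ.IsHermitian) {t : ℝ} (ht : 0 < t)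
    (h : ∀ E : Matrix (a × b) (a × b) ℂ, E.PosSemidef → (1 - partialTraceA E).PosSemidef →
      (ρ * E).trace.re ≤ t) :
    ∃ υ : Matrix b b ℂ, υ.PosSemidef ∧ ρ ≤ (1 : Matrix a a ℂ) ⊗ₖ υ ∧ υ.trace.re ≤ t := by
  by_contra! hcon
  set T : Set (Matrix b b ℂ) := {υ | υ.PosSemidef ∧ υ.trace.re ≤ t}
  set D : Set (Matrix (a × b) (a × b) ℂ) :=
    (fun υ : Matrix b b ℂ => ρ - (1 : Matrix a a ℂ) ⊗ₖ υ) '' T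
  set C : Set (Matrix (a × b) (a × b) ℂ) := {H | ∀ x, (star x ⬝ᵥ (H *ᵥ x)).re ≤ 0} with hC
  have hDc : IsCompact D := by
    refine (isCompact_posSemidef_trace_le t).image ?_
    refine continuous_const.sub (continuous_matrix fun i j => ?_)
    simp only [Matrix.kroneckerMap_apply]
    exact continuous_const.mul (continuous_id.matrix_elem _ _)
  have hDconv : Convex ℝ D := by
    rintro _ ⟨x, hx, rfl⟩ _ ⟨y, hy, rfl⟩ p q hp hq hpq
    refine ⟨p • x + q • y, convex_posSemidef_trace_le t hx hy hp hq hpq, ?_⟩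
    have : ρ = p • ρ + q • ρ := by rw [← add_smul, hpq, one_smul]
    simp only [Matrix.kronecker_add, Matrix.kronecker_smul, smul_sub]
    conv_lhs => rw [this]
    abel
  have hCc : IsClosed C := by
    rw [hC, Set.ofPred_forall]
    refine isClosed_iInter fun x => isClosed_le ?_ continuous_const
    exact Complex.continuous_re.comp
      (continuous_const.dotProduct (continuous_id.matrix_mulVec continuous_const))
  have hCconv : Convex ℝ C := by
    intro x hx y hy p q hp hq _ v
    have h1 := mul_nonpos_of_nonneg_of_nonpos hp (hx v)
    have h2 := mul_nonpos_of_nonneg_of_nonpos hq (hy v)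
    simp only [Matrix.add_mulVec, Matrix.smul_mulVec, dotProduct_add, dotProduct_smul,
      Complex.add_re, Complex.smul_re, smul_eq_mul]
    linarith
  have hdisj : Disjoint C D := by
    rw [Set.disjoint_left]
    rintro _ hH ⟨υ, ⟨hυ, hυt⟩, rfl⟩
    refine absurd hυt (hcon υ hυ ?_).not_ge
    refine Matrix.le_iff.2 (posSemidef_of_re_nonneg ?_ fun x => ?_)
    · refine Matrix.IsHermitian.sub ?_ hρ
      rw [Matrix.IsHermitian, Matrix.conjTranspose_kronecker, hυ.isHermitian.eq,
        Matrix.conjTranspose_one]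
    · have := hH x
      rw [← neg_sub, Matrix.neg_mulVec, dotProduct_neg, Complex.neg_re]
      linarith
  obtain ⟨f, u, v, hfu, huv, hfv⟩ :=
    RCLike.geometric_hahn_banach_closed_compact (𝕜 := ℂ) hCconv hCc hDconv hDc hdisj
  obtain ⟨G, hG⟩ := exists_trace_mul_eq (f : Matrix (a × b) (a × b) ℂ →ₗ[ℂ] ℂ)
  simp only [ContinuousLinearMap.coe_coe] at hG
  simp only [hG, RCLike.re_eq_complex_re] at hfu hfv
  have hu : 0 < u := by simpa using hfu 0 fun x => by simp
  -- The Hermitian part of the separating functional, up to a factor of two.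
  set E := G + Gᴴ with hE
  have hEtr (M : Matrix (a × b) (a × b) ℂ) (hM : M.IsHermitian) :
      (M * E).trace.re = 2 * (G * M).trace.re := by
    have h1 : (M * Gᴴ).trace = star (G * M).trace := by
      rw [← Matrix.trace_conjTranspose, Matrix.conjTranspose_mul, hM.eq]
    rw [hE, mul_add, Matrix.trace_add, h1, Matrix.trace_mul_comm M G, Complex.add_re,
      Complex.star_def, Complex.conj_re]
    ring
  have hEpsd : E.PosSemidef := by
    refine posSemidef_of_re_nonneg (by simp [Matrix.IsHermitian, hE, add_comm]) fun x => ?_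
    have hx : (vecMulVec x (star x)).IsHermitian := by
      simp [Matrix.IsHermitian, Matrix.conjTranspose_vecMulVec]
    rw [← trace_mul_vecMulVec_star, Matrix.trace_mul_comm, hEtr _ hx]
    by_contra! hneg
    set c := (G * vecMulVec x (star x)).trace.re with hc
    have hc0 : c < 0 := by linarith
    -- Scaling along a ray of the cone `C` breaks the bound `u`.
    have := hfu (-((u / (-c)) • vecMulVec x (star x))) fun y => by
      have : 0 ≤ (star y ⬝ᵥ (vecMulVec x (star x) *ᵥ y)).re :=
        (Matrix.posSemidef_vecMulVec_self_star x).re_dotProduct_nonneg y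
      have h2 : 0 ≤ u / (-c) := by apply div_nonneg <;> linarith
      rw [Matrix.neg_mulVec, Matrix.smul_mulVec, dotProduct_neg, dotProduct_smul, Complex.neg_re,
        Complex.smul_re, smul_eq_mul]
      have := mul_nonneg h2 this
      linarith
    rw [mul_neg, Matrix.trace_neg, Matrix.mul_smul, Matrix.trace_smul, Complex.neg_re,
      Complex.smul_re, smul_eq_mul, ← hc] at this
    have h3 : u / (-c) * c = -u := by rw [div_neg, neg_mul, div_mul_cancel₀ _ hc0.ne]
    linarith
  have hsep (υ : Matrix b b ℂ) (hυ : υ ∈ T) :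
      2 * v + (υ * partialTraceA E).trace.re < (ρ * E).trace.re := by
    have h1 := hfv _ ⟨υ, hυ, rfl⟩
    have hh : (ρ - (1 : Matrix a a ℂ) ⊗ₖ υ).IsHermitian := by
      refine hρ.sub ?_
      rw [Matrix.IsHermitian, Matrix.conjTranspose_kronecker, hυ.1.isHermitian.eq,
        Matrix.conjTranspose_one]
    have h2 := hEtr _ hh
    rw [sub_mul, Matrix.trace_sub, Complex.sub_re, trace_one_kronecker_mul] at h2
    linarith
  have hs := hsep 0 ⟨.zero, by simpa using ht.le⟩
  simp only [zero_mul, Matrix.trace_zero, Complex.zero_re, add_zero] at hs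
  set s := (ρ * E).trace.re - 2 * v
  have hs0 : 0 < s := by linarith
  have hEA : (partialTraceA E).PosSemidef := posSemidef_partialTraceA hEpsd
  -- The rank-one matrices `υ = t |x⟩⟨x| / ‖x‖²` show that `Tr_A E ≤ s / t`.
  have hEB (x : b → ℂ) : t * (star x ⬝ᵥ (partialTraceA E *ᵥ x)).re ≤ s * (star x ⬝ᵥ x).re := by
    rcases eq_or_ne x 0 with rfl | hx
    · simp
    have hxpos : 0 < (star x ⬝ᵥ x).re := (Complex.pos_iff.1 (dotProduct_star_self_pos_iff.2 hx)).1
    have := hsep ((t / (star x ⬝ᵥ x).re) • vecMulVec x (star x))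
      ⟨(Matrix.posSemidef_vecMulVec_self_star x).smul (by positivity), by
        rw [Matrix.trace_smul, Matrix.trace_vecMulVec, dotProduct_comm x, Complex.smul_re,
          smul_eq_mul, div_mul_cancel₀ _ hxpos.ne']⟩
    rw [Matrix.smul_mul, Matrix.trace_smul, Matrix.trace_mul_comm, trace_mul_vecMulVec_star,
      Complex.smul_re, smul_eq_mul, div_mul_eq_mul_div] at this
    have h2 : t * (star x ⬝ᵥ (partialTraceA E *ᵥ x)).re / (star x ⬝ᵥ x).re < s := by linarith
    exact ((div_lt_iff₀ hxpos).1 h2).le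
  have hts : 0 ≤ t / s := by positivity
  have key := h ((t / s) • E) (hEpsd.smul hts) (by
    rw [partialTraceA_smul]
    refine posSemidef_of_re_nonneg
      (Matrix.isHermitian_one.sub (hEA.smul hts).isHermitian) fun x => ?_
    rw [Matrix.sub_mulVec, Matrix.one_mulVec, dotProduct_sub, Matrix.smul_mulVec, dotProduct_smul,
      Complex.sub_re, Complex.smul_re, smul_eq_mul, div_mul_eq_mul_div, sub_nonneg,
      div_le_iff₀ hs0, mul_comm _ s]
    exact hEB x)
  rw [Matrix.mul_smul, Matrix.trace_smul, Complex.smul_re, smul_eq_mul, div_mul_eq_mul_div,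
    div_le_iff₀ hs0] at key
  have := le_of_mul_le_mul_left key ht
  linarith

/-! ### Supports -/

theorem supportPow_zero_mul {M : Matrix n n ℂ} [Fintype n] [DecidableEq n] (hM : M.PosSemidef) :
    supportPow M 0 * M = M := by
  rw [supportPow_mul_self hM, zero_add, supportPow_one hM]

/-- The support projection of `Tr_A (L Lᴴ)` fixes the range of `L`. -/
theorem one_kronecker_supportPow_zero_mul [Fintype a] [Fintype b] [DecidableEq a] [DecidableEq b]
    (L : Matrix (a × b) (a × b) ℂ) :
    (1 : Matrix a a ℂ) ⊗ₖ supportPow (partialTraceA (L * Lᴴ)) 0 * L = L := by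
  set X := partialTraceA (L * Lᴴ) with hX
  have hXp : X.PosSemidef := posSemidef_partialTraceA (Matrix.posSemidef_self_mul_conjTranspose L)
  set P := supportPow X 0
  have h0 : ((1 : Matrix a a ℂ) ⊗ₖ (1 - P)) * L = 0 := by
    rw [← Matrix.trace_mul_conjTranspose_self_eq_zero_iff, Matrix.conjTranspose_mul,
      ← Matrix.mul_assoc, Matrix.mul_assoc _ L, Matrix.mul_assoc, trace_one_kronecker_mul,
      Matrix.conjTranspose_kronecker, Matrix.conjTranspose_one, partialTraceA_mul_one_kronecker,
      ← hX, ← Matrix.mul_assoc, sub_mul, one_mul, supportPow_zero_mul hXp, sub_self, zero_mul,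
      Matrix.trace_zero]
  have h1 : (1 : Matrix a a ℂ) ⊗ₖ (1 - P) = 1 - 1 ⊗ₖ P := by
    rw [eq_sub_iff_add_eq, ← Matrix.kronecker_add, sub_add_cancel, Matrix.one_kronecker_one]
  rw [h1, sub_mul, one_mul, sub_eq_zero] at h0
  exact h0.symm

/-- The support of `ρ` is contained in that of `ρ_A ⊗ 1`. -/
theorem supportPow_zero_kronecker_one_mul [Fintype a] [Fintype b] [DecidableEq a] [DecidableEq b]
    {ρ : Matrix (a × b) (a × b) ℂ} (hρ : ρ.PosSemidef) :
    supportPow (partialTraceB ρ) 0 ⊗ₖ (1 : Matrix b b ℂ) * ρ = ρ := by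
  have hσ := posSemidef_partialTraceB hρ
  obtain ⟨Q, hQ, hQρ⟩ := exists_isHermitian_mul_self hρ
  set P := supportPow (partialTraceB ρ) 0
  have hPh : Pᴴ = P := (posSemidef_supportPow _ _).isHermitian.eq
  have h0 : ((1 - P) ⊗ₖ (1 : Matrix b b ℂ)) * Q = 0 := by
    rw [← Matrix.trace_mul_conjTranspose_self_eq_zero_iff, Matrix.conjTranspose_mul, hQ.eq,
      Matrix.conjTranspose_kronecker, Matrix.conjTranspose_one, Matrix.conjTranspose_sub,
      Matrix.conjTranspose_one, hPh, Matrix.mul_assoc, ← Matrix.mul_assoc Q, hQρ,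
      Matrix.trace_mul_comm, Matrix.mul_assoc, Matrix.trace_mul_comm, Matrix.mul_assoc,
      trace_kronecker_one_mul, partialTraceB_kronecker_one_mul, sub_mul 1 P (partialTraceB ρ),
      one_mul, supportPow_zero_mul hσ, sub_self, mul_zero, Matrix.trace_zero]
  have h1 : (1 - P) ⊗ₖ (1 : Matrix b b ℂ) = 1 - P ⊗ₖ 1 := by
    rw [eq_sub_iff_add_eq, ← Matrix.add_kronecker, sub_add_cancel, Matrix.one_kronecker_one]
  rw [h1, sub_mul, one_mul, sub_eq_zero] at h0
  rw [← hQρ, ← Matrix.mul_assoc, ← h0]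

/-! ### Operators with bounded marginal -/

/-- If `Wᴴ W ≤ t` then `W Wᴴ ≤ t`. -/
theorem posSemidef_smul_one_sub_mul_conjTranspose [Fintype n] [DecidableEq n] [Fintype m]
    [DecidableEq m] {W : Matrix m n ℂ} {t : ℝ} (ht : 0 < t)
    (h : (t • (1 : Matrix n n ℂ) - Wᴴ * W).PosSemidef) :
    (t • (1 : Matrix m m ℂ) - W * Wᴴ).PosSemidef := by
  -- With `Z = W Wᴴ`, both `(t - Z)²` and `t Z - Z²` are nonnegative and sum to `t (t - Z)`.
  have h1 := h.mul_mul_conjTranspose_same W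
  have h2 := Matrix.posSemidef_self_mul_conjTranspose (t • (1 : Matrix m m ℂ) - W * Wᴴ)
  have h3 : t • (1 : Matrix m m ℂ) - W * Wᴴ =
      t⁻¹ • (W * (t • (1 : Matrix n n ℂ) - Wᴴ * W) * Wᴴ +
        (t • (1 : Matrix m m ℂ) - W * Wᴴ) * (t • (1 : Matrix m m ℂ) - W * Wᴴ)ᴴ) := by
    rw [eq_inv_smul_iff₀ ht.ne']
    simp only [Matrix.conjTranspose_sub, Matrix.conjTranspose_smul, Matrix.conjTranspose_one,
      Matrix.conjTranspose_mul, Matrix.conjTranspose_conjTranspose, star_trivial, Matrix.mul_sub,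
      Matrix.sub_mul, Matrix.mul_smul, Matrix.smul_mul, Matrix.mul_one, Matrix.one_mul, smul_sub,
      Matrix.mul_assoc]
    abel
  rw [h3]
  exact (h1.add h2).smul (inv_nonneg.2 ht.le)

/-- If `Tr_A (Gᴴ G) ≤ 1`, then `(S ⊗ 1)ᴴ Gᴴ G (S ⊗ 1) ≤ Tr (S Sᴴ)`. This is the Cauchy–Schwarz
inequality `‖∑ S_ik G (e_i ⊗ z_k)‖² ≤ ∑ |S_ik|² ∑ ‖G (e_i ⊗ z_k)‖²`. -/
theorem posSemidef_trace_smul_one_sub [Fintype a] [Fintype b] [DecidableEq a] [DecidableEq b]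
    (G : Matrix (a × b) (a × b) ℂ) (S : Matrix a a ℂ)
    (hG : (1 - partialTraceA (Gᴴ * G)).PosSemidef) :
    ((S * Sᴴ).trace.re • (1 : Matrix (a × b) (a × b) ℂ) -
      (G * S ⊗ₖ (1 : Matrix b b ℂ))ᴴ * (G * S ⊗ₖ (1 : Matrix b b ℂ))).PosSemidef := by
  refine posSemidef_of_re_nonneg ?_ fun z => ?_
  · refine Matrix.IsHermitian.sub ?_ (Matrix.isHermitian_conjTranspose_mul_self _)
    simp [Matrix.IsHermitian]
  -- `g r i k` is the component of `G (e_i ⊗ z_k)` along the basis vector `r`.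
  set g : a × b → a → a → ℂ := fun r i k => ∑ j, G r (i, j) * z (k, j) with hg
  have hW (r : a × b) : ((G * S ⊗ₖ (1 : Matrix b b ℂ)) *ᵥ z) r = ∑ p : a × a,
      S p.1 p.2 * g r p.1 p.2 := by
    simp only [Matrix.mulVec, dotProduct, Matrix.mul_apply, Fintype.sum_prod_type,
      Matrix.kroneckerMap_apply, Matrix.one_apply, mul_ite, mul_one, mul_zero, hg,
      Finset.sum_ite_eq', Finset.mul_sum, Finset.sum_mul, Finset.mem_univ, if_true]
    rw [Finset.sum_comm' (t' := Finset.univ) (s' := fun _ => Finset.univ) (by simp)]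
    conv_rhs => rw [Finset.sum_comm]
    conv_lhs => rw [Finset.sum_comm]
    refine Finset.sum_congr rfl fun k _ => ?_
    rw [Finset.sum_comm]
    exact Finset.sum_congr rfl fun i _ => Finset.sum_congr rfl fun j _ => by ring
  have hnorm : (star z ⬝ᵥ
      (((G * S ⊗ₖ (1 : Matrix b b ℂ))ᴴ * (G * S ⊗ₖ (1 : Matrix b b ℂ))) *ᵥ z)).re =
      ∑ r, ‖((G * S ⊗ₖ (1 : Matrix b b ℂ)) *ᵥ z) r‖ ^ 2 := by
    rw [← star_dotProduct_self_re, ← Matrix.mulVec_mulVec, Matrix.dotProduct_mulVec,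
      Matrix.star_mulVec]
  have hCS (r : a × b) : ‖((G * S ⊗ₖ (1 : Matrix b b ℂ)) *ᵥ z) r‖ ^ 2 ≤
      (S * Sᴴ).trace.re * ∑ p : a × a, ‖g r p.1 p.2‖ ^ 2 := by
    rw [hW, trace_mul_conjTranspose_self_re, ← Fintype.sum_prod_type']
    refine le_trans ?_ (Finset.sum_mul_sq_le_sq_mul_sq _ _ _)
    refine pow_le_pow_left₀ (norm_nonneg _) ?_ 2
    exact (norm_sum_le _ _).trans (Finset.sum_le_sum fun p _ => (norm_mul _ _).le)
  have hgk (k : a) : ∑ r, ∑ i, ‖g r i k‖ ^ 2 ≤ ∑ j, ‖z (k, j)‖ ^ 2 := by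
    have h1 := hG.re_dotProduct_nonneg fun j => z (k, j)
    rw [Matrix.sub_mulVec, Matrix.one_mulVec, dotProduct_sub, map_sub, RCLike.re_eq_complex_re,
      star_dotProduct_self_re, sub_nonneg] at h1
    refine le_trans (le_of_eq ?_) h1
    have h2 : partialTraceA (Gᴴ * G) = ∑ i, (G.submatrix id (Prod.mk i))ᴴ *
        G.submatrix id (Prod.mk i) := by
      rw [partialTraceA_eq_sum]
      rfl
    rw [h2, Matrix.sum_mulVec, dotProduct_sum, Complex.re_sum, Finset.sum_comm]
    refine Finset.sum_congr rfl fun i _ => ?_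
    rw [← Matrix.mulVec_mulVec, Matrix.dotProduct_mulVec, ← Matrix.star_mulVec,
      star_dotProduct_self_re]
    rfl
  have ht : 0 ≤ (S * Sᴴ).trace.re := trace_re_nonneg (Matrix.posSemidef_self_mul_conjTranspose S)
  rw [Matrix.sub_mulVec, dotProduct_sub, Matrix.smul_mulVec, Matrix.one_mulVec, dotProduct_smul,
    Complex.sub_re, Complex.smul_re, star_dotProduct_self_re, smul_eq_mul, hnorm, sub_nonneg]
  refine (Finset.sum_le_sum fun r _ => hCS r).trans ?_
  rw [← Finset.mul_sum]
  refine mul_le_mul_of_nonneg_left ?_ ht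
  simp only [Fintype.sum_prod_type_right (f := fun p : a × a => ‖g _ p.1 p.2‖ ^ 2)]
  rw [Finset.sum_comm, Fintype.sum_prod_type]
  exact Finset.sum_le_sum fun k _ => hgk k

/-- If `E ≥ 0` and `Tr_A E ≤ 1`, then `Tr_A (E (S Sᴴ ⊗ 1) E) ≤ Tr (S Sᴴ)`. -/
theorem posSemidef_trace_smul_one_sub_partialTraceA [Fintype a] [Fintype b] [DecidableEq a]
    [DecidableEq b] {E : Matrix (a × b) (a × b) ℂ} (hE : E.PosSemidef)
    (hE1 : (1 - partialTraceA E).PosSemidef) {S : Matrix a a ℂ} (hS : 0 < (S * Sᴴ).trace.re) :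
    ((S * Sᴴ).trace.re • (1 : Matrix b b ℂ) -
      partialTraceA (E * S ⊗ₖ (1 : Matrix b b ℂ) * (E * S ⊗ₖ (1 : Matrix b b ℂ))ᴴ)).PosSemidef := by
  obtain ⟨G, hG, rfl⟩ := exists_isHermitian_mul_self hE
  set t := (S * Sᴴ).trace.re
  obtain ⟨W, hW⟩ : ∃ W, W = G * S ⊗ₖ (1 : Matrix b b ℂ) := ⟨_, rfl⟩
  have h1 := posSemidef_trace_smul_one_sub G S (by rwa [hG.eq])
  rw [← hW] at h1
  have h2 := posSemidef_smul_one_sub_mul_conjTranspose hS h1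
  have h3 := posSemidef_partialTraceA (h2.mul_mul_conjTranspose_same G)
  have h4 := hE1.smul hS.le
  have h5 : G * (t • 1 - W * Wᴴ) * Gᴴ = t • (G * G) - G * W * (G * W)ᴴ := by
    rw [mul_sub, sub_mul, hG.eq, Matrix.mul_smul, mul_one, Matrix.smul_mul,
      Matrix.conjTranspose_mul, hG.eq]
    simp only [Matrix.mul_assoc]
  rw [h5, partialTraceA_sub, partialTraceA_smul] at h3
  have h6 := h3.add h4
  rwa [smul_sub, add_comm, sub_add_sub_cancel, hW, ← Matrix.mul_assoc] at h6

/-! ### The two bounds -/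

/-- With `X = Tr_A (L Lᴴ)`, weighting the Cauchy–Schwarz inequality by `X ^ (∓1/4)` on `B` bounds
`Re Tr (L Nᴴ)` by `√c Tr √X` whenever `Tr_A (N Nᴴ) ≤ c`. -/
theorem re_trace_mul_conjTranspose_sq_le [Fintype a] [Fintype b] [DecidableEq a] [DecidableEq b]
    (L N : Matrix (a × b) (a × b) ℂ) {c : ℝ}
    (hN : (c • (1 : Matrix b b ℂ) - partialTraceA (N * Nᴴ)).PosSemidef) :
    (L * Nᴴ).trace.re ^ 2 ≤ c * (supportPow (partialTraceA (L * Lᴴ)) (1 / 2)).trace.re ^ 2 := by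
  have hX : (partialTraceA (L * Lᴴ)).PosSemidef :=
    posSemidef_partialTraceA (Matrix.posSemidef_self_mul_conjTranspose L)
  have hL := one_kronecker_supportPow_zero_mul L
  set X := partialTraceA (L * Lᴴ) with hXdef
  obtain ⟨J, hJ⟩ : ∃ J, J = supportPow X (-(1 / 4)) := ⟨_, rfl⟩
  obtain ⟨K, hK⟩ : ∃ K, K = supportPow X (1 / 4) := ⟨_, rfl⟩
  have hJh : Jᴴ = J := hJ ▸ (posSemidef_supportPow X _).isHermitian.eq
  have hKh : Kᴴ = K := hK ▸ (posSemidef_supportPow X _).isHermitian.eq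
  have hKJ : K * J = supportPow X 0 := by rw [hJ, hK, supportPow_mul]; norm_num
  have hKK : K * K = supportPow X (1 / 2) := by rw [hK, supportPow_mul]; norm_num
  have hJJX : J * J * X = supportPow X (1 / 2) := by
    rw [hJ, supportPow_mul, supportPow_mul_self hX]; norm_num
  have hLK : (1 : Matrix a a ℂ) ⊗ₖ K * ((1 : Matrix a a ℂ) ⊗ₖ J * L) = L := by
    rw [← Matrix.mul_assoc, ← Matrix.mul_kronecker_mul, hKJ, one_mul, hL]
  have h1 : (L * Nᴴ).trace =
      (((1 : Matrix a a ℂ) ⊗ₖ J * L) * (Nᴴ * (1 : Matrix a a ℂ) ⊗ₖ K)).trace := by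
    conv_lhs => rw [← hLK]
    rw [Matrix.mul_assoc, Matrix.trace_mul_comm, Matrix.mul_assoc]
  have h2 : (((1 : Matrix a a ℂ) ⊗ₖ J * L) * ((1 : Matrix a a ℂ) ⊗ₖ J * L)ᴴ).trace =
      (supportPow X (1 / 2)).trace := by
    rw [Matrix.conjTranspose_mul, Matrix.conjTranspose_kronecker, Matrix.conjTranspose_one, hJh,
      Matrix.mul_assoc, ← Matrix.mul_assoc L, trace_one_kronecker_mul,
      partialTraceA_mul_one_kronecker, ← hXdef, ← Matrix.mul_assoc, Matrix.trace_mul_comm,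
      ← Matrix.mul_assoc, hJJX]
  have h3 : ((Nᴴ * (1 : Matrix a a ℂ) ⊗ₖ K)ᴴ * (Nᴴ * (1 : Matrix a a ℂ) ⊗ₖ K)).trace =
      (supportPow X (1 / 2) * partialTraceA (N * Nᴴ)).trace := by
    rw [Matrix.conjTranspose_mul, Matrix.conjTranspose_kronecker, Matrix.conjTranspose_one, hKh,
      Matrix.conjTranspose_conjTranspose, Matrix.mul_assoc, ← Matrix.mul_assoc N,
      trace_one_kronecker_mul, partialTraceA_mul_one_kronecker, ← Matrix.mul_assoc,
      Matrix.trace_mul_comm, ← Matrix.mul_assoc, hKK]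
  have h4 := re_trace_mul_sq_le ((1 : Matrix a a ℂ) ⊗ₖ J * L) (Nᴴ * (1 : Matrix a a ℂ) ⊗ₖ K)
  rw [← h1, h2, h3] at h4
  have h5 := re_trace_mul_nonneg (posSemidef_supportPow X (1 / 2)) hN
  rw [mul_sub, Matrix.mul_smul, mul_one, Matrix.trace_sub, Matrix.trace_smul, Complex.sub_re,
    Complex.smul_re, smul_eq_mul] at h5
  have h6 := trace_re_nonneg (posSemidef_supportPow X (1 / 2))
  nlinarith

theorem conjTranspose_supportPow_kronecker_one [Fintype a] [DecidableEq a] [DecidableEq b]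
    (M : Matrix a a ℂ) (s : ℝ) :
    (supportPow M s ⊗ₖ (1 : Matrix b b ℂ))ᴴ = supportPow M s ⊗ₖ 1 := by
  rw [Matrix.conjTranspose_kronecker, Matrix.conjTranspose_one,
    (posSemidef_supportPow M s).isHermitian.eq]

/-- `M ^ s` cannot vanish, because multiplying it by `M ^ (1 - s)` recovers `M`. -/
theorem trace_supportPow_pos [Fintype n] [DecidableEq n] {M : Matrix n n ℂ} (hM : M.PosSemidef)
    (hM0 : M ≠ 0) (s : ℝ) : 0 < (supportPow M s).trace.re := by
  have hp := posSemidef_supportPow M s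
  refine lt_of_le_of_ne (trace_re_nonneg hp) fun h0 => hM0 ?_
  have h1 : (supportPow M s).trace = 0 :=
    Complex.ext h0.symm (Complex.nonneg_iff.1 hp.trace_nonneg).2.symm
  have h2 := supportPow_mul M s (1 - s)
  rwa [hp.trace_eq_zero_iff.1 h1, zero_mul, add_sub_cancel, supportPow_one hM, eq_comm] at h2

theorem IsDensityMatrix.ne_zero [Fintype a] [Fintype b]
    {ρ : Matrix (a × b) (a × b) ℂ} (hρ : IsDensityMatrix ρ) : ρ ≠ 0 := by
  rintro rfl
  simpa using hρ.trace_eq_one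

theorem IsDensityMatrix.partialTraceB_ne_zero [Fintype a] [Fintype b]
    {ρ : Matrix (a × b) (a × b) ℂ} (hρ : IsDensityMatrix ρ) : partialTraceB ρ ≠ 0 := by
  intro h
  have := trace_partialTraceB ρ
  rw [h, hρ.trace_eq_one] at this
  simp at this

section Bounds

variable [Fintype a] [Fintype b] [DecidableEq a] [DecidableEq b]
  {ρ : Matrix (a × b) (a × b) ℂ}

/-- The operator `ρ (ρ_A ^ (-s/2) ⊗ 1)`, a square root of `ρ (ρ_A ^ (-s) ⊗ 1) ρ`. -/
noncomputable def weightedRoot (ρ : Matrix (a × b) (a × b) ℂ) (s : ℝ) : Matrix (a × b) (a × b) ℂ :=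
  ρ * supportPow (partialTraceB ρ) (-s / 2) ⊗ₖ (1 : Matrix b b ℂ)

theorem supportPow_kronecker_one_mul (M : Matrix a a ℂ) (s t : ℝ) :
    supportPow M s ⊗ₖ (1 : Matrix b b ℂ) * supportPow M t ⊗ₖ 1 = supportPow M (s + t) ⊗ₖ 1 := by
  rw [← Matrix.mul_kronecker_mul, supportPow_mul, one_mul]

theorem weightedRoot_mul_conjTranspose (hρ : ρ.PosSemidef) (s : ℝ) :
    weightedRoot ρ s * (weightedRoot ρ s)ᴴ =
      ρ * (supportPow (partialTraceB ρ) (-s) ⊗ₖ (1 : Matrix b b ℂ)) * ρ := by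
  rw [weightedRoot, Matrix.conjTranspose_mul, conjTranspose_supportPow_kronecker_one,
    hρ.isHermitian.eq, Matrix.mul_assoc, ← Matrix.mul_assoc _ _ ρ, supportPow_kronecker_one_mul,
    add_halves, Matrix.mul_assoc]

theorem weightedRootTrace_eq (hρ : ρ.PosSemidef) (s : ℝ) :
    weightedRootTrace ρ s =
      (supportPow (partialTraceA (weightedRoot ρ s * (weightedRoot ρ s)ᴴ)) (1 / 2)).trace.re := by
  rw [weightedRootTrace, ← weightedRoot_mul_conjTranspose hρ, sqrt_eq_supportPow
    (posSemidef_partialTraceA (Matrix.posSemidef_self_mul_conjTranspose _))]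

/-- The powers of `ρ_A` cancel to its support projection, which `ρ` absorbs. -/
theorem weightedRoot_mul_supportPow (hρ : ρ.PosSemidef) (s : ℝ) :
    weightedRoot ρ s * supportPow (partialTraceB ρ) (s / 2) ⊗ₖ (1 : Matrix b b ℂ) = ρ := by
  rw [weightedRoot, Matrix.mul_assoc, supportPow_kronecker_one_mul, neg_div, neg_add_cancel]
  have := congrArg Matrix.conjTranspose (supportPow_zero_kronecker_one_mul hρ)
  rwa [Matrix.conjTranspose_mul, conjTranspose_supportPow_kronecker_one, hρ.isHermitian.eq] at this

/-- If the trace vanished, so would `L = ρ (ρ_A ^ (-s/2) ⊗ 1)`, from which `ρ` is recovered by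
multiplication with `ρ_A ^ (s/2) ⊗ 1`. -/
theorem weightedRootTrace_pos (hρ : IsDensityMatrix ρ) (s : ℝ) : 0 < weightedRootTrace ρ s := by
  have hp := hρ.posSemidef
  rw [weightedRootTrace_eq hp]
  refine trace_supportPow_pos
    (posSemidef_partialTraceA (Matrix.posSemidef_self_mul_conjTranspose _)) (fun h0 => ?_) _
  have h1 := trace_partialTraceA (weightedRoot ρ s * (weightedRoot ρ s)ᴴ)
  rw [h0, Matrix.trace_zero, eq_comm, Matrix.trace_mul_conjTranspose_self_eq_zero_iff] at h1
  have h2 := weightedRoot_mul_supportPow hp s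
  rw [h1, zero_mul] at h2
  exact hρ.ne_zero h2.symm

/-- Every dual feasible `E` has value at most `√(Tr ρ_A ^ s) Tr_B √(Tr_A (ρ ρ_A ^ (-s) ρ))`: write
`Tr (ρ E) = Tr (L Nᴴ)` with `L = ρ ρ_A ^ (-s/2)` and `N = E ρ_A ^ (s/2)`. -/
theorem re_trace_mul_le_weightedRootTrace (hρ : IsDensityMatrix ρ) (s : ℝ)
    {E : Matrix (a × b) (a × b) ℂ} (hE : E.PosSemidef)
    (hE1 : (1 - partialTraceA E).PosSemidef) :
    (ρ * E).trace.re ≤ Real.sqrt (supportPow (partialTraceB ρ) s).trace.re *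
      weightedRootTrace ρ s := by
  have hp := hρ.posSemidef
  have hS : supportPow (partialTraceB ρ) (s / 2) * (supportPow (partialTraceB ρ) (s / 2))ᴴ =
      supportPow (partialTraceB ρ) s := by
    rw [(posSemidef_supportPow _ _).isHermitian.eq, supportPow_mul, add_halves]
  have hpos := trace_supportPow_pos (posSemidef_partialTraceB hp) hρ.partialTraceB_ne_zero s
  have h1 := posSemidef_trace_smul_one_sub_partialTraceA hE hE1
    (S := supportPow (partialTraceB ρ) (s / 2)) (by rwa [hS])
  have h2 := re_trace_mul_conjTranspose_sq_le (weightedRoot ρ s) _ h1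
  rw [Matrix.conjTranspose_mul, conjTranspose_supportPow_kronecker_one, hE.isHermitian.eq,
    ← Matrix.mul_assoc, weightedRoot_mul_supportPow hp, hS, ← weightedRootTrace_eq hp] at h2
  have h3 := (weightedRootTrace_pos hρ s).le
  refine le_of_abs_le (abs_le_of_sq_le_sq ?_ (by positivity))
  rwa [mul_pow, Real.sq_sqrt hpos.le]

/-- Every trace of a feasible `υ` is at least
`(Tr_B √(Tr_A (ρ ρ_A ^ (-s) ρ)))² / Tr ρ_A ^ (1 - s)`. With `L = ρ ρ_A ^ (-s/2)` and
`X = Tr_A (L Lᴴ)`, the dual feasible point `E = X ^ (-1/2) L Lᴴ X ^ (-1/2)` (of the form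
of a pretty good measurement) witnesses this. -/
theorem weightedRootTrace_sq_le (hρ : IsDensityMatrix ρ) (s : ℝ) {υ : Matrix b b ℂ}
    (hυ : υ.PosSemidef) (hle : ρ ≤ (1 : Matrix a a ℂ) ⊗ₖ υ) :
    weightedRootTrace ρ s ^ 2 ≤ υ.trace.re * (supportPow (partialTraceB ρ) (1 - s)).trace.re := by
  have hp := hρ.posSemidef
  have hσ := posSemidef_partialTraceB hp
  rw [weightedRootTrace_eq hp]
  set L := weightedRoot ρ s with hL
  have hX : (partialTraceA (L * Lᴴ)).PosSemidef :=
    posSemidef_partialTraceA (Matrix.posSemidef_self_mul_conjTranspose L)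
  set X := partialTraceA (L * Lᴴ) with hXdef
  obtain ⟨J, hJ⟩ : ∃ J, J = supportPow X (-(1 / 2)) := ⟨_, rfl⟩
  have hJh : Jᴴ = J := hJ ▸ (posSemidef_supportPow X _).isHermitian.eq
  have hJX : J * X = supportPow X (1 / 2) := by rw [hJ, supportPow_mul_self hX]; norm_num
  obtain ⟨J', hJ'⟩ : ∃ J', J' = (1 : Matrix a a ℂ) ⊗ₖ J := ⟨_, rfl⟩
  have hJh' : J'ᴴ = J' := by
    rw [hJ', Matrix.conjTranspose_kronecker, Matrix.conjTranspose_one, hJh]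
  have hE : (J' * (L * Lᴴ) * J').PosSemidef := by
    simpa [hJh'] using
      (Matrix.posSemidef_self_mul_conjTranspose L).mul_mul_conjTranspose_same J'
  have hE1 : (1 - partialTraceA (J' * (L * Lᴴ) * J')).PosSemidef := by
    rw [hJ', partialTraceA_mul_one_kronecker, partialTraceA_one_kronecker_mul, ← hXdef, hJX, hJ,
      supportPow_mul, add_neg_cancel]
    exact posSemidef_one_sub_supportPow_zero X
  have hdual := re_trace_mul_le_of_le_one_kronecker hυ hle hE hE1
  obtain ⟨Q, hQ, hQρ⟩ := exists_isHermitian_mul_self hp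
  obtain ⟨R, hR⟩ : ∃ R, R = supportPow (partialTraceB ρ) (-s / 2) ⊗ₖ (1 : Matrix b b ℂ) := ⟨_, rfl⟩
  have hRh : Rᴴ = R := hR ▸ conjTranspose_supportPow_kronecker_one _ _
  have hLQ : L = Q * Q * R := by rw [hL, weightedRoot, hQρ, hR]
  have hLh : Lᴴ = R * (Q * Q) := by
    rw [hLQ, Matrix.conjTranspose_mul, Matrix.conjTranspose_mul, hRh, hQ.eq]
  have hCS := re_trace_mul_sq_le (Q * J' * L) (R * Q)
  have h1 : (Q * J' * L * (R * Q)).trace = (supportPow X (1 / 2)).trace := by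
    rw [← hJX, hXdef, ← trace_one_kronecker_mul, ← hJ', hLh, Matrix.mul_assoc, Matrix.mul_assoc,
      Matrix.trace_mul_comm]
    simp only [Matrix.mul_assoc]
  have h2 : (Q * J' * L * (Q * J' * L)ᴴ).trace = (ρ * (J' * (L * Lᴴ) * J')).trace := by
    rw [← hQρ, Matrix.conjTranspose_mul, Matrix.conjTranspose_mul, hQ.eq, hJh',
      Matrix.mul_assoc Q Q, Matrix.trace_mul_comm Q]
    simp only [Matrix.mul_assoc]
  have h3 : ((R * Q)ᴴ * (R * Q)).trace = (supportPow (partialTraceB ρ) (1 - s)).trace := by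
    rw [Matrix.conjTranspose_mul, hQ.eq, hRh, Matrix.mul_assoc, Matrix.trace_mul_comm,
      Matrix.mul_assoc, Matrix.mul_assoc, hQρ, ← Matrix.mul_assoc, hR,
      supportPow_kronecker_one_mul, trace_kronecker_one_mul, supportPow_mul_self hσ]
    congr 2; ring
  rw [h1, h2, h3] at hCS
  exact hCS.trans (mul_le_mul_of_nonneg_right hdual (trace_re_nonneg (posSemidef_supportPow _ _)))

end Bounds

end QuantumMinEntropy

theorem mainTheorem3 {a b : Type*} [Fintype a] [Fintype b] [DecidableEq a] [DecidableEq b]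
    (ρ : Matrix (a × b) (a × b) ℂ) (hρ : QuantumMinEntropy.IsDensityMatrix ρ) (s : ℝ) :
    - Real.logb 2
        (Real.sqrt (QuantumMinEntropy.supportPow (QuantumMinEntropy.partialTraceB ρ) s).trace.re
          * QuantumMinEntropy.weightedRootTrace ρ s)
      ≤ QuantumMinEntropy.condMinEntropy ρ ∧
    QuantumMinEntropy.condMinEntropy ρ
      ≤ - Real.logb 2
        (QuantumMinEntropy.weightedRootTrace ρ s ^ 2
          / (QuantumMinEntropy.supportPow (QuantumMinEntropy.partialTraceB ρ) (1 - s)).trace.re) := by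
  open QuantumMinEntropy in
  have hσ := posSemidef_partialTraceB hρ.posSemidef
  have hw := weightedRootTrace_pos hρ s
  have hpos := trace_supportPow_pos hσ hρ.partialTraceB_ne_zero s
  have hpos' := trace_supportPow_pos hσ hρ.partialTraceB_ne_zero (1 - s)
  have hupper : 0 < Real.sqrt (supportPow (partialTraceB ρ) s).trace.re * weightedRootTrace ρ s :=
    mul_pos (Real.sqrt_pos.2 hpos) hw
  -- The logarithm is monotone only on positive reals, so both bounds must be positive.
  have hlower : 0 < weightedRootTrace ρ s ^ 2 /
      (supportPow (partialTraceB ρ) (1 - s)).trace.re := by positivity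
  have hbound : ∀ t ∈ feasibleTraces ρ, weightedRootTrace ρ s ^ 2 /
      (supportPow (partialTraceB ρ) (1 - s)).trace.re ≤ t := by
    rintro _ ⟨υ, hυ, hle, rfl⟩
    exact (div_le_iff₀ hpos').2 (weightedRootTrace_sq_le hρ s hυ hle)
  obtain ⟨υ, hυ, hle, ht⟩ := exists_posSemidef_le_one_kronecker hρ.posSemidef.isHermitian hupper
    fun E hE hE1 => re_trace_mul_le_weightedRootTrace hρ s hE hE1
  have hmem : υ.trace.re ∈ feasibleTraces ρ := ⟨υ, hυ, hle, rfl⟩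
  have h1 := le_csInf ⟨_, hmem⟩ hbound
  have h2 := (csInf_le ⟨_, hbound⟩ hmem).trans ht
  exact ⟨neg_le_neg (Real.logb_le_logb_of_le one_lt_two (hlower.trans_le h1) h2),
    neg_le_neg (Real.logb_le_logb_of_le one_lt_two hlower h1)⟩
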